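/- Let $k$ be an algebraically closed field. Let $A$ and $B$ be reduced commutative $k$-algebras (not necessarily of finite type over $k$) such that $\operatorname{Spec}(A)$ and $\operatorname{Spec}(B)$ are connected (in particular nonempty). Let $u \in A \otimes_k B$ be a unit. Then there exist units $a \in A^*$ and $b \in B^*$ such that $u = a \otimes b$. -/

import Mathlib

open scoped TensorProduct

/-! Injectivity of tensoring over a field reduces to finite type `A` and `B`; connectedness survives
as the absence of nontrivial idempotents. View `u` as a function of points `(x, y)`. It is a pure
tensor once `u(x,y) u(x₀,y₀) = u(x,y₀) u(x₀,y)`. For domains, `u(·,y)/u(·,y₀)` lies in every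
valuation ring of `Frac A` over `k` (`exists_evalRight_eq_algebraMap_mul`), hence in `k`.
Connectedness glues the irreducible components (`exists_eq_algebraMap_of_forall_prime`). -/

/-! ### Evaluation at rational points. -/

section Points

variable {k : Type*} [Field k]

/-- Evaluation of the right factor of a tensor product at a rational point. -/
noncomputable def evalRight (R : Type*) {B : Type*} [CommRing R] [CommRing B]
    [Algebra k R] [Algebra k B] (y : B →ₐ[k] k) : R ⊗[k] B →ₐ[k] R :=
  (Algebra.TensorProduct.rid k k R).toAlgHom.comp
    (Algebra.TensorProduct.map (AlgHom.id k R) y)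

@[simp]
lemma evalRight_tmul {R B : Type*} [CommRing R] [CommRing B] [Algebra k R] [Algebra k B]
    (y : B →ₐ[k] k) (r : R) (b : B) : evalRight R y (r ⊗ₜ b) = y b • r := by
  simp [evalRight]

lemma evalRight_map {R S B C : Type*} [CommRing R] [CommRing S] [CommRing B] [CommRing C]
    [Algebra k R] [Algebra k S] [Algebra k B] [Algebra k C] (f : R →ₐ[k] S) (g : B →ₐ[k] C)
    (y : C →ₐ[k] k) (w : R ⊗[k] B) :
    evalRight S y (Algebra.TensorProduct.map f g w) = f (evalRight R (y.comp g) w) := by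
  have : (evalRight S y).comp (Algebra.TensorProduct.map f g) =
      f.comp (evalRight R (y.comp g)) := by
    ext <;> simp
  exact congr($this w)

lemma apply_evalRight_comm {A B : Type*} [CommRing A] [CommRing B] [Algebra k A] [Algebra k B]
    (x : A →ₐ[k] k) (y : B →ₐ[k] k) (w : A ⊗[k] B) :
    y (evalRight B x (Algebra.TensorProduct.comm k A B w)) = x (evalRight A y w) := by
  have : (y.comp (evalRight B x)).comp (Algebra.TensorProduct.comm k A B).toAlgHom =
      x.comp (evalRight A y) := by
    ext <;> simp
  exact congr($this w)

/-- Nullstellensatz: a residue field of `B[1/b]` is `k`. -/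
lemma exists_algHom_apply_ne_zero [IsAlgClosed k] {B : Type*} [CommRing B] [Algebra k B]
    [Algebra.FiniteType k B] {b : B} (hb : ¬ IsNilpotent b) : ∃ y : B →ₐ[k] k, y b ≠ 0 := by
  let S := Localization.Away b
  have : Nontrivial S := by
    by_contra h
    rw [not_nontrivial_iff_subsingleton] at h
    exact hb ((IsLocalization.subsingleton_iff (M := Submonoid.powers b) (S := S)).1 h)
  have : Algebra.FiniteType k S := inferInstanceAs (Algebra.FiniteType k (Localization.Away b))
  obtain ⟨m, hm⟩ := Ideal.exists_maximal S
  let := Ideal.Quotient.field m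
  have : Module.Finite k (S ⧸ m) := finite_of_finite_type_of_isJacobsonRing k (S ⧸ m)
  let e : k ≃ₐ[k] (S ⧸ m) := AlgEquiv.ofBijective (Algebra.ofId k (S ⧸ m))
    (IsAlgClosed.algebraMap_bijective_of_isIntegral)
  let f : B →ₐ[k] (S ⧸ m) := (Ideal.Quotient.mkₐ k m).comp (IsScalarTower.toAlgHom k B S)
  refine ⟨e.symm.toAlgHom.comp f, fun h ↦ ?_⟩
  have h' : f b = 0 := by simpa using h
  exact (((IsLocalization.Away.algebraMap_isUnit (S := S) b).map
    (Ideal.Quotient.mkₐ k m)).ne_zero) h'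

/-- `b` is a nonzero coefficient of `w` in a `k`-basis of `L`; `y b` is then a coordinate of the
value at `y`. -/
lemma exists_separating_coefficient {L B : Type*} [CommRing L] [CommRing B] [Algebra k L]
    [Algebra k B] {w : L ⊗[k] B} (hw : w ≠ 0) :
    ∃ b : B, b ≠ 0 ∧ ∀ y : B →ₐ[k] k, y b ≠ 0 → evalRight L y w ≠ 0 := by
  classical
  let ℬ := Module.Basis.ofVectorSpace k L
  obtain ⟨i, hi⟩ : ∃ i, TensorProduct.equivFinsuppOfBasisLeft ℬ w i ≠ 0 := by
    by_contra! h
    exact hw ((TensorProduct.equivFinsuppOfBasisLeft (N := B) ℬ).injective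
      (by ext i; simpa using h i))
  refine ⟨_, hi, fun y hy h ↦ hy ?_⟩
  have : y.toLinearMap ∘ₗ Finsupp.lapply i ∘ₗ
      (TensorProduct.equivFinsuppOfBasisLeft (N := B) ℬ).toLinearMap =
      ℬ.coord i ∘ₗ (evalRight L y).toLinearMap := by
    ext a b
    simp [mul_comm]
  simpa [h] using congr($this w)

lemma eq_zero_of_evalRight_eq_zero [IsAlgClosed k] {L B : Type*} [CommRing L] [CommRing B]
    [Algebra k L] [Algebra k B] [Algebra.FiniteType k B] [IsReduced B] {w : L ⊗[k] B}
    (hw : ∀ y : B →ₐ[k] k, evalRight L y w = 0) : w = 0 := by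
  by_contra h
  obtain ⟨b, hb, H⟩ := exists_separating_coefficient h
  obtain ⟨y, hy⟩ := exists_algHom_apply_ne_zero (k := k) (mt IsNilpotent.eq_zero hb)
  exact H y hy (hw y)

lemma exists_evalRight_ne_zero_and_ne_zero [IsAlgClosed k] {L B : Type*} [CommRing L] [CommRing B]
    [IsDomain B] [Algebra k L] [Algebra k B] [Algebra.FiniteType k B] {w z : L ⊗[k] B}
    (hw : w ≠ 0) (hz : z ≠ 0) :
    ∃ y : B →ₐ[k] k, evalRight L y w ≠ 0 ∧ evalRight L y z ≠ 0 := by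
  obtain ⟨b, hb, H⟩ := exists_separating_coefficient hw
  obtain ⟨c, hc, H'⟩ := exists_separating_coefficient hz
  obtain ⟨y, hy⟩ := exists_algHom_apply_ne_zero (k := k)
    (mt IsNilpotent.eq_zero (mul_ne_zero hb hc))
  rw [map_mul] at hy
  exact ⟨y, H y (left_ne_zero_of_mul hy), H' y (right_ne_zero_of_mul hy)⟩

end Points

/-! ### Units over a valuation ring. -/

section Valuation

variable {k : Type*} [Field k] {V K B : Type*} [CommRing V] [IsDomain V] [ValuationRing V]
  [Field K] [Algebra V K] [IsFractionRing V K] [Algebra k V] [Algebra k K] [IsScalarTower k V K]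
  [CommRing B] [Algebra k B]

variable (V) in
/-- Dividing by a coefficient of maximal valuation makes a tensor integral and primitive. -/
lemma exists_primitive_tensor {w : K ⊗[k] B} (hw : w ≠ 0) :
    ∃ (a : K) (v : V ⊗[k] B),
      w = (a ⊗ₜ 1) * Algebra.TensorProduct.map (IsScalarTower.toAlgHom k V K) (AlgHom.id k B) v ∧
      Algebra.TensorProduct.map (IsScalarTower.toAlgHom k V (IsLocalRing.ResidueField V))
        (AlgHom.id k B) v ≠ 0 := by
  classical
  let ℬ := Module.Basis.ofVectorSpace k B
  let c := TensorProduct.equivFinsuppOfBasisRight (M := K) ℬ w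
  have hc : c ≠ 0 := by simpa [c] using hw
  obtain ⟨m, hm, hmax⟩ := c.support.exists_max_image (fun i ↦ ValuationRing.valuation V K (c i))
    (Finsupp.support_nonempty_iff.2 hc)
  have hm0 : c m ≠ 0 := by simpa using hm
  have hint (i) : ∃ r : V, algebraMap V K r = c i / c m := by
    rw [← ValuationRing.mem_integer_iff, Valuation.mem_integer_iff, map_div₀]
    by_cases hi : c i = 0
    · simp [hi]
    · exact div_le_one_of_le₀ (hmax i (by simpa using hi)) zero_le
  choose r hr using hint
  refine ⟨c m, ∑ i ∈ c.support, r i ⊗ₜ ℬ i, ?_, fun h ↦ ?_⟩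
  · have : w = c.sum fun i x ↦ x ⊗ₜ ℬ i := by
      rw [← TensorProduct.equivFinsuppOfBasisRight_symm_apply, LinearEquiv.symm_apply_apply]
    rw [this]
    simp [Finsupp.sum, Finset.mul_sum, hr, mul_div_cancel₀ _ hm0]
  · replace h := congr(TensorProduct.equivFinsuppOfBasisRight ℬ $h m)
    have hr1 : r m = 1 := by
      apply IsFractionRing.injective V K
      simp [hr, hm0]
    simp [Finsupp.single_apply, hr1, hm0, Finsupp.finsetSum_apply] at h

lemma exists_evalRight_eq_algebraMap_mul [IsAlgClosed k] [IsDomain B] [Algebra.FiniteType k B]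
    {u : K ⊗[k] B} (hu : IsUnit u) (y y₀ : B →ₐ[k] k) :
    ∃ c : V, evalRight K y u = algebraMap V K c * evalRight K y₀ u := by
  obtain ⟨u', huu'⟩ := hu.exists_right_inv
  have : Nontrivial (K ⊗[k] B) := (evalRight K y).toRingHom.domain_nontrivial
  obtain ⟨a, v, hv, hv0⟩ := exists_primitive_tensor V hu.ne_zero
  obtain ⟨a', v', hv', hv0'⟩ := exists_primitive_tensor V (right_ne_zero_of_mul_eq_one huu')
  have key (z : B →ₐ[k] k) :
      -- The product `v(z) v'(z)` is therefore independent of `z`; it is a unit of `V` at a point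
      -- where both reductions are nonzero, hence everywhere.
      a * algebraMap V K (evalRight V z v) * (a' * algebraMap V K (evalRight V z v')) = 1 := by
    have := congr(evalRight K z $huu')
    rw [hv, hv'] at this
    simpa only [map_mul, evalRight_map, evalRight_tmul, map_one, one_smul, AlgHom.comp_id,
      IsScalarTower.coe_toAlgHom'] using this
  obtain ⟨z, hz, hz'⟩ := exists_evalRight_ne_zero_and_ne_zero hv0 hv0'
  simp only [evalRight_map, AlgHom.comp_id] at hz hz'
  have hz : IsUnit (evalRight V z v) := by simpa using hz
  have hz' : IsUnit (evalRight V z v') := by simpa using hz'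
  have key' : evalRight V y₀ v * evalRight V y₀ v' = evalRight V z v * evalRight V z v' := by
    apply IsFractionRing.injective V K
    have h1 := key y₀
    have h2 := key z
    have : a * a' ≠ 0 := by
      intro h
      apply zero_ne_one (α := K)
      linear_combination h1 - algebraMap V K (evalRight V y₀ v) * algebraMap V K (evalRight V y₀ v') * h
    apply mul_left_cancel₀ this
    simp only [map_mul]
    linear_combination h1 - h2
  have hy₀ : IsUnit (evalRight V y₀ v) := isUnit_of_mul_isUnit_left (key' ▸ hz.mul hz')
  obtain ⟨d, hd⟩ := hy₀.exists_left_inv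
  refine ⟨evalRight V y v * d, ?_⟩
  rw [hv]
  simp only [map_mul, evalRight_map, evalRight_tmul, map_one, one_smul, AlgHom.comp_id]
  have := congr(algebraMap V K $hd)
  simp only [map_mul, map_one] at this
  simp only [IsScalarTower.coe_toAlgHom']
  linear_combination (-a * algebraMap V K (evalRight V y v)) * this

end Valuation

/-! ### Ratios of values over domains are constant. -/

section Domain

variable {k : Type*} [Field k] [IsAlgClosed k]

lemma mem_range_algebraMap_of_forall_valuationSubring {K : Type*} [Field K] [Algebra k K] {t : K}
    (ht : ∀ V : ValuationSubring K, (∀ r : k, algebraMap k K r ∈ V) → t ∈ V) :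
    t ∈ (algebraMap k K).range := by
  have h : t ∈ (integralClosure (Subring.closure ((algebraMap k K).range : Set K)) K).toSubring := by
    -- The valuation rings containing a subring intersect in its integral closure.
    rw [← iInf_valuationSubring_superset, Subring.mem_iInf]
    rintro ⟨V, hV⟩
    exact ht V fun r ↦ hV ⟨r, rfl⟩
  rw [Subring.closure_eq] at h
  have h' : IsIntegral (algebraMap k K).range t := h
  have : IsIntegral k t := by
    obtain ⟨p, hp, hpt⟩ := h'
    obtain ⟨q, hq, -, hq'⟩ := Polynomial.lifts_and_degree_eq_and_monic
      (Polynomial.map_surjective _ (algebraMap k K).rangeRestrict_surjective p) hp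
    refine ⟨q, hq', ?_⟩
    rw [← hq, Polynomial.eval₂_map] at hpt
    exact hpt
  have : Algebra.IsIntegral k (IntermediateField.adjoin k {t}) :=
    have := IntermediateField.adjoin.finiteDimensional this
    inferInstance
  obtain ⟨c, hc⟩ := (IsAlgClosed.algebraMap_bijective_of_isIntegral (k := k)
    (K := IntermediateField.adjoin k {t})).2 ⟨t, IntermediateField.mem_adjoin_simple_self k t⟩
  exact ⟨c, congr(($hc : K))⟩

lemma exists_evalRight_eq_smul {A B : Type*} [CommRing A] [IsDomain A] [CommRing B] [IsDomain B]
    [Algebra k A] [Algebra k B] [Algebra.FiniteType k B] {u : A ⊗[k] B} (hu : IsUnit u)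
    (y y₀ : B →ₐ[k] k) : ∃ c : k, evalRight A y u = c • evalRight A y₀ u := by
  let K := FractionRing A
  let φ := Algebra.TensorProduct.map (IsScalarTower.toAlgHom k A K) (AlgHom.id k B)
  have hφ : IsUnit (φ u) := hu.map φ
  have h0 : evalRight K y₀ (φ u) ≠ 0 := (hφ.map _).ne_zero
  obtain ⟨c, hc⟩ := mem_range_algebraMap_of_forall_valuationSubring (k := k)
    (t := evalRight K y (φ u) / evalRight K y₀ (φ u)) fun V hV ↦ by
      let : Algebra k V := ((algebraMap k K).codRestrict V.toSubring hV).toAlgebra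
      have : IsScalarTower k V K := .of_algebraMap_eq fun _ ↦ rfl
      obtain ⟨d, hd⟩ := exists_evalRight_eq_algebraMap_mul (V := V) hφ y y₀
      rw [hd, mul_div_cancel_right₀ _ h0]
      exact d.2
  refine ⟨c, IsFractionRing.injective A K ?_⟩
  rw [eq_div_iff h0] at hc
  simpa [φ, evalRight_map, Algebra.smul_def, ← IsScalarTower.algebraMap_apply] using hc.symm

end Domain

/-! ### Gluing constants along a connected spectrum. -/

section Connected

variable {k : Type*} [Field k]

lemma eq_zero_or_eq_one_of_connectedSpace {A : Type*} [CommRing A]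
    [ConnectedSpace (PrimeSpectrum A)] {e : A} (he : IsIdempotentElem e) : e = 0 ∨ e = 1 := by
  rcases isClopen_iff.1 (PrimeSpectrum.isClopen_iff.2 ⟨e, he, rfl⟩) with h | h
  · exact .inl (PrimeSpectrum.basicOpen_injOn_isIdempotentElem he .zero (SetLike.ext' (by simpa using h)))
  · exact .inr (PrimeSpectrum.basicOpen_injOn_isIdempotentElem he .one (SetLike.ext' (by simpa using h)))

lemma exists_eq_algebraMap_of_prod_eq_zero {B : Type*} [CommRing B] [Nontrivial B] [Algebra k B]
    (hB : ∀ e : B, IsIdempotentElem e → e = 0 ∨ e = 1) (g : B) (S : Finset k)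
    (hS : ∏ c ∈ S, (g - algebraMap k B c) = 0) : ∃ c, g = algebraMap k B c := by
  classical
  induction S using Finset.induction_on with
  | empty => simp at hS
  | insert c S hc ih =>
    rw [Finset.prod_insert hc] at hS
    let p : Polynomial k := ∏ d ∈ S, (Polynomial.X - Polynomial.C d)
    have hp : Polynomial.aeval g p = ∏ d ∈ S, (g - algebraMap k B d) := by simp [p, map_prod]
    have hpc : p.eval c ≠ 0 := by
      simp only [p, Polynomial.eval_prod, Finset.prod_ne_zero_iff]
      intro d hd
      simpa [sub_eq_zero] using fun h : c = d ↦ hc (h ▸ hd)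
    obtain ⟨q, hq⟩ := Polynomial.X_sub_C_dvd_sub_C_eval (a := c) (p := p)
    replace hq := congr(Polynomial.aeval g $hq)
    simp only [map_sub, map_mul, Polynomial.aeval_X, Polynomial.aeval_C, hp] at hq
    set P := ∏ d ∈ S, (g - algebraMap k B d)
    have hinv : algebraMap k B (p.eval c)⁻¹ * algebraMap k B (p.eval c) = 1 := by
      rw [← map_mul, inv_mul_cancel₀ hpc, map_one]
    set i := algebraMap k B (p.eval c)⁻¹
    -- Modulo `g - c`, `P` is the nonzero scalar `p(c)`; since `(g - c) P = 0`, `P / p(c)` is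
    -- idempotent.
    rcases hB (i * P) (by
      show i * P * (i * P) = i * P
      linear_combination (i * i * P) * hq + i * P * hinv + i * i * Polynomial.aeval g q * hS)
      with h | h
    · exact ih (by linear_combination algebraMap k B (p.eval c) * h - P * hinv)
    · exact ⟨c, by linear_combination i * hS - (g - algebraMap k B c) * h⟩

lemma exists_eq_algebraMap_of_forall_prime [IsAlgClosed k] {B : Type*} [CommRing B] [Nontrivial B]
    [Algebra k B] [Algebra.FiniteType k B] [IsReduced B]
    (hB : ∀ e : B, IsIdempotentElem e → e = 0 ∨ e = 1) (g : B)
    (hg : ∀ q : Ideal B, q.IsPrime → ∀ y y₀ : B →ₐ[k] k, (∀ b ∈ q, y b = 0) →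
      (∀ b ∈ q, y₀ b = 0) → y g = y₀ g) : ∃ c, g = algebraMap k B c := by
  classical
  have : IsNoetherianRing B := Algebra.FiniteType.isNoetherianRing k B
  have hconst (q : Ideal B) (hq : q.IsPrime) : ∃ c : k, g - algebraMap k B c ∈ q := by
    obtain ⟨y₀, -⟩ := exists_algHom_apply_ne_zero (k := k) (B := B ⧸ q) (b := 1) (by simp)
    refine ⟨y₀ (Ideal.Quotient.mk q g), ?_⟩
    by_contra h
    obtain ⟨y, hy⟩ := exists_algHom_apply_ne_zero (k := k) (B := B ⧸ q)
      (b := Ideal.Quotient.mk q (g - algebraMap k B (y₀ (Ideal.Quotient.mk q g))))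
      (mt IsNilpotent.eq_zero (by rwa [Ideal.Quotient.eq_zero_iff_mem]))
    have := hg q hq (y.comp (Ideal.Quotient.mkₐ k q)) (y₀.comp (Ideal.Quotient.mkₐ k q))
      (fun b hb ↦ by simp [Ideal.Quotient.eq_zero_iff_mem.2 hb])
      (fun b hb ↦ by simp [Ideal.Quotient.eq_zero_iff_mem.2 hb])
    apply hy
    have h2 : y (Ideal.Quotient.mk q (algebraMap k B (y₀ (Ideal.Quotient.mk q g)))) =
        y₀ (Ideal.Quotient.mk q g) := y.commutes _
    rw [map_sub, map_sub, h2]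
    simpa [sub_eq_zero] using this
  choose! c hc using hconst
  have hfin := minimalPrimes.finite_of_isNoetherianRing B
  refine exists_eq_algebraMap_of_prod_eq_zero hB g (hfin.toFinset.image c) ?_
  apply IsNilpotent.eq_zero
  rw [← mem_nilradical, nilradical, ← Ideal.sInf_minimalPrimes, Ideal.mem_sInf]
  intro q hq
  exact Ideal.mem_of_dvd _ (Finset.dvd_prod_of_mem _
    (Finset.mem_image_of_mem c (hfin.mem_toFinset.2 hq))) (hc q hq.1.1)

end Connected

/-! ### The finite type case. -/

section FiniteType

variable {k : Type*} [Field k] [IsAlgClosed k] {A B : Type*} [CommRing A] [CommRing B]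
  [Algebra k A] [Algebra k B] [Algebra.FiniteType k B]

lemma apply_evalRight_mul_eq_of_prime {u : A ⊗[k] B} (hu : IsUnit u) (p : Ideal A) [p.IsPrime]
    (q : Ideal B) [q.IsPrime] {x x₀ : A →ₐ[k] k} (hx : ∀ a ∈ p, x a = 0) (hx₀ : ∀ a ∈ p, x₀ a = 0)
    {y y₀ : B →ₐ[k] k} (hy : ∀ b ∈ q, y b = 0) (hy₀ : ∀ b ∈ q, y₀ b = 0) :
    x (evalRight A y u) * x₀ (evalRight A y₀ u) = x (evalRight A y₀ u) * x₀ (evalRight A y u) := by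
  let φ := Algebra.TensorProduct.map (Ideal.Quotient.mkₐ k p) (Ideal.Quotient.mkₐ k q)
  obtain ⟨c, hc⟩ := exists_evalRight_eq_smul (hu.map φ) (Ideal.Quotient.liftₐ q y hy)
    (Ideal.Quotient.liftₐ q y₀ hy₀)
  simp only [φ, evalRight_map] at hc
  have e1 : (Ideal.Quotient.liftₐ q y hy).comp (Ideal.Quotient.mkₐ k q) = y := rfl
  have e2 : (Ideal.Quotient.liftₐ q y₀ hy₀).comp (Ideal.Quotient.mkₐ k q) = y₀ := rfl
  rw [e1, e2] at hc
  have h1 : x (evalRight A y u) = c * x (evalRight A y₀ u) :=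
    congr(Ideal.Quotient.liftₐ p x hx $hc).trans (map_smul _ _ _)
  have h2 : x₀ (evalRight A y u) = c * x₀ (evalRight A y₀ u) :=
    congr(Ideal.Quotient.liftₐ p x₀ hx₀ $hc).trans (map_smul _ _ _)
  rw [h1, h2]
  ring

variable [Algebra.FiniteType k A] [IsReduced A] [IsReduced B] [Nontrivial A] [Nontrivial B]

lemma apply_evalRight_mul_eq (hA : ∀ e : A, IsIdempotentElem e → e = 0 ∨ e = 1)
    (hB : ∀ e : B, IsIdempotentElem e → e = 0 ∨ e = 1) {u : A ⊗[k] B} (hu : IsUnit u)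
    (x x₀ : A →ₐ[k] k) (y y₀ : B →ₐ[k] k) :
    x (evalRight A y u) * x₀ (evalRight A y₀ u) = x (evalRight A y₀ u) * x₀ (evalRight A y u) := by
  have ne (x : A →ₐ[k] k) (y : B →ₐ[k] k) : x (evalRight A y u) ≠ 0 :=
    ((hu.map (evalRight A y)).map x).ne_zero
  have step (p : Ideal A) (hp : p.IsPrime) (x x₀ : A →ₐ[k] k) (hx : ∀ a ∈ p, x a = 0)
      (hx₀ : ∀ a ∈ p, x₀ a = 0) (y y₀ : B →ₐ[k] k) : x (evalRight A y u) * x₀ (evalRight A y₀ u) =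
        x (evalRight A y₀ u) * x₀ (evalRight A y u) := by
    -- With `x`, `x₀` on one component, `u(x,·)/u(x₀,·)` is constant on each component of `Spec B`,
    -- hence constant.
    let u' := Algebra.TensorProduct.comm k A B u
    obtain ⟨d, hd⟩ := ((hu.map (Algebra.TensorProduct.comm k A B)).map
      (evalRight B x₀)).exists_right_inv
    have hd' (y : B →ₐ[k] k) : x₀ (evalRight A y u) * y d = 1 := by
      simpa only [map_mul, apply_evalRight_comm, map_one] using congr(y $hd)
    obtain ⟨c, hc⟩ := exists_eq_algebraMap_of_forall_prime hB (evalRight B x u' * d)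
      fun q hq y y₀ hy hy₀ ↦ by
        have := apply_evalRight_mul_eq_of_prime hu p q hx hx₀ hy hy₀
        simp only [map_mul, u', apply_evalRight_comm]
        linear_combination (y d * y₀ d) * this + x (evalRight A y₀ u) * y₀ d * hd' y
          - x (evalRight A y u) * y d * hd' y₀
    have hc' (y : B →ₐ[k] k) : x (evalRight A y u) * y d = c := by
      have := congr(y $hc)
      simpa only [map_mul, u', apply_evalRight_comm, AlgHom.commutes, Algebra.algebraMap_self_apply]
        using this
    have hc'' (y : B →ₐ[k] k) : x (evalRight A y u) = c * x₀ (evalRight A y u) := by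
      linear_combination x₀ (evalRight A y u) * hc' y - x (evalRight A y u) * hd' y
    rw [hc'' y, hc'' y₀]
    ring
  -- Now `step` makes `u(·,y)/u(·,y₀)` constant on each component of `Spec A`.
  obtain ⟨d, hd⟩ := (hu.map (evalRight A y₀)).exists_right_inv
  obtain ⟨c, hc⟩ := exists_eq_algebraMap_of_forall_prime hA (evalRight A y u * d)
    fun p hp x x₀ hx hx₀ ↦ by
      have := step p hp x x₀ hx hx₀ y y₀
      have h1 := congr(x $hd)
      have h2 := congr(x₀ $hd)
      simp only [map_mul, map_one] at h1 h2 ⊢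
      linear_combination (x d * x₀ d) * this + x₀ (evalRight A y u) * x₀ d * h1
          - x (evalRight A y u) * x d * h2
  have hc' : evalRight A y u = algebraMap k A c * evalRight A y₀ u := by
    linear_combination evalRight A y₀ u * hc - evalRight A y u * hd
  rw [hc']
  simp only [map_mul, AlgHom.commutes]
  ring

lemma exists_eq_tmul_of_isUnit_of_finiteType
    (hA : ∀ e : A, IsIdempotentElem e → e = 0 ∨ e = 1)
    (hB : ∀ e : B, IsIdempotentElem e → e = 0 ∨ e = 1) {u : A ⊗[k] B} (hu : IsUnit u) :
    ∃ (a : A) (b : B), IsUnit a ∧ IsUnit b ∧ u = a ⊗ₜ[k] b := by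
  obtain ⟨x₀, -⟩ := exists_algHom_apply_ne_zero (k := k) (B := A) (b := 1) (by simp)
  obtain ⟨y₀, -⟩ := exists_algHom_apply_ne_zero (k := k) (B := B) (b := 1) (by simp)
  have h0 : x₀ (evalRight A y₀ u) ≠ 0 := ((hu.map (evalRight A y₀)).map x₀).ne_zero
  let b := evalRight B x₀ (Algebra.TensorProduct.comm k A B u)
  have hb : IsUnit b := (hu.map (Algebra.TensorProduct.comm k A B)).map (evalRight B x₀)
  refine ⟨(x₀ (evalRight A y₀ u))⁻¹ • evalRight A y₀ u, b,
    (hu.map (evalRight A y₀)).smul (Units.mk0 _ (inv_ne_zero h0)), hb, ?_⟩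
  rw [← sub_eq_zero]
  refine eq_zero_of_evalRight_eq_zero fun y ↦ ?_
  by_contra h
  obtain ⟨x, hx⟩ := exists_algHom_apply_ne_zero (k := k) (mt IsNilpotent.eq_zero h)
  apply hx
  have := apply_evalRight_mul_eq hA hB hu x x₀ y y₀
  simp only [map_sub, evalRight_tmul, map_smul, smul_eq_mul, b, apply_evalRight_comm]
  field_simp
  linear_combination this

end FiniteType

/-! ### Descent to finitely generated subalgebras. -/

section Descent

lemma exists_subalgebra_fg_forall_mem_range {k A B : Type*} [Field k] [CommRing A] [CommRing B]
    [Algebra k A] [Algebra k B] {s : Set (A ⊗[k] B)} (hs : s.Finite) :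
    ∃ (A₀ : Subalgebra k A) (B₀ : Subalgebra k B), A₀.FG ∧ B₀.FG ∧
      ∀ w ∈ s, ∃ w₀ : A₀ ⊗[k] B₀, Algebra.TensorProduct.map A₀.val B₀.val w₀ = w := by
  obtain ⟨M, N, hM, hN, h⟩ := TensorProduct.exists_finite_submodule_of_setFinite s hs
  obtain ⟨S, rfl⟩ := Module.Finite.iff_fg.1 hM
  obtain ⟨T, rfl⟩ := Module.Finite.iff_fg.1 hN
  refine ⟨Algebra.adjoin k S, Algebra.adjoin k T, ⟨S, rfl⟩, ⟨T, rfl⟩, fun w hw ↦ ?_⟩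
  obtain ⟨w, rfl⟩ := h hw
  clear hw
  refine ⟨TensorProduct.map (Submodule.inclusion (Algebra.span_le_adjoin k (S : Set A)))
    (Submodule.inclusion (Algebra.span_le_adjoin k (T : Set B))) w, ?_⟩
  induction w with
  | zero => simp
  | add x y hx hy => simp only [map_add, hx, hy]
  | tmul x y => rfl

end Descent

theorem mainTheorem5 {k : Type*} {A : Type*} {B : Type*} [Field k] [IsAlgClosed k]
    [CommRing A] [Algebra k A] [IsReduced A] [ConnectedSpace (PrimeSpectrum A)]
    [CommRing B] [Algebra k B] [IsReduced B] [ConnectedSpace (PrimeSpectrum B)]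
    (u : A ⊗[k] B) (hu : IsUnit u) :
    ∃ (a : A) (b : B), IsUnit a ∧ IsUnit b ∧ u = a ⊗ₜ[k] b := by
  have : Nontrivial A := PrimeSpectrum.nonempty_iff_nontrivial.1 inferInstance
  have : Nontrivial B := PrimeSpectrum.nonempty_iff_nontrivial.1 inferInstance
  obtain ⟨v, huv⟩ := hu.exists_right_inv
  obtain ⟨A₀, B₀, hA₀, hB₀, h⟩ := exists_subalgebra_fg_forall_mem_range (Set.toFinite {u, v})
  obtain ⟨u₀, rfl⟩ := h u (by simp)
  obtain ⟨v₀, rfl⟩ := h v (by simp)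
  have inj : Function.Injective (Algebra.TensorProduct.map A₀.val B₀.val) :=
    TensorProduct.map_injective_of_flat_flat _ _ Subtype.val_injective Subtype.val_injective
  rw [← map_mul, ← map_one (Algebra.TensorProduct.map A₀.val B₀.val)] at huv
  have hu₀ : IsUnit u₀ := .of_mul_eq_one _ (inj huv)
  have := A₀.fg_iff_finiteType.1 hA₀
  have := B₀.fg_iff_finiteType.1 hB₀
  have : IsReduced A₀ := isReduced_of_injective A₀.val Subtype.val_injective
  have : IsReduced B₀ := isReduced_of_injective B₀.val Subtype.val_injective
  obtain ⟨a, b, ha, hb, hab⟩ := exists_eq_tmul_of_isUnit_of_finiteType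
    (fun e he ↦ by simpa using eq_zero_or_eq_one_of_connectedSpace (he.map A₀.val))
    (fun e he ↦ by simpa using eq_zero_or_eq_one_of_connectedSpace (he.map B₀.val)) hu₀
  exact ⟨a, b, ha.map A₀.val, hb.map B₀.val, by simp [hab]⟩
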